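/- Let $n, s, d$ be positive integers, let $\xi \in (0,1)$ and $\varepsilon > 0$, and suppose that $d \ge 2\varepsilon^{-2}\log(n/\xi)$ and $m = ds$. Let $A = (a_{j,k})$ be a random $m \times n$ matrix with entries in $\{0,1\}$ whose columns are independent and such that each column has exactly $d$ ones, in positions drawn uniformly from $\{1,\dots,m\}$ without replacement. Call $z \in \mathbb{R}^n$ $s$-sparse if it has at most $s$ non-zero coordinates. Then, with probability greater than $1-\xi$, the bounds $$ d\,(1 - 2e^{-1} - 2\varepsilon)\,\|z\|_1 \;\le\; \|Az\|_1 \;\le\; d\,\|z\|_1 $$ and $$ d\,(1 - e^{-1} - \varepsilon)\,\|z\|_1 \;\le\; \sum_{j=1}^m \Big( \sum_{k=1}^n a_{j,k}\, z_k^2 \Big)^{1/2} $$ hold simultaneously for all $s$-sparse $z \in \mathbb{R}^n$. In particular, on the same event, $A/d$ has the 1-restricted isometry property of order $s$ and level $\theta = 2e^{-1} + 2\varepsilon$, that is, $(1-\theta)\|z\|_1 \le \|(A/d) z\|_1 \le (1+\theta)\|z\|_1$ for all $s$-sparse $z \in \mathbb{R}^n$. -/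

import Mathlib

open MeasureTheory ProbabilityTheory

/-- The `ℓ₁` norm of a real vector. -/
def l1norm {k : ℕ} (v : Fin k → ℝ) : ℝ := ∑ i, |v i|

/-- `z` has at most `s` non-zero coordinates. -/
def IsSparse {n : ℕ} (s : ℕ) (z : Fin n → ℝ) : Prop := (Function.support z).ncard ≤ s

/-- The 1-restricted isometry property of order `s` and level `θ`. -/
def HasOneRIP {m n : ℕ} (Φ : Matrix (Fin m) (Fin n) ℝ) (s : ℕ) (θ : ℝ) : Prop :=
  ∀ z : Fin n → ℝ, IsSparse s z →
    (1 - θ) * l1norm z ≤ l1norm (Φ.mulVec z) ∧ l1norm (Φ.mulVec z) ≤ (1 + θ) * l1norm z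

/-- The 0/1 vectors of length `m` with exactly `d` ones. -/
def binaryColumns (m d : ℕ) : Set (Fin m → ℝ) :=
  {v | (∀ j, v j = 0 ∨ v j = 1) ∧ {j | v j = 1}.ncard = d}

/-- `A` is a random `m × n` binary matrix with `d` ones per column, the positions of the ones
being drawn uniformly without replacement, independently for the different columns: every column
is uniformly distributed on the 0/1 vectors with exactly `d` ones. -/
structure IsRandomBinaryMatrix {Ω : Type*} [MeasurableSpace Ω] (P : Measure Ω) {m n : ℕ} (d : ℕ)
    (A : Ω → Matrix (Fin m) (Fin n) ℝ) : Prop where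
  measurable_col : ∀ k, Measurable (fun ω j => A ω j k)
  indep_col : iIndepFun (fun k ω j => A ω j k) P
  law_col : ∀ k, P.map (fun ω j => A ω j k) = uniformOn (binaryColumns m d)

/-! Everything follows from expansion: each set `J` of at most `s` columns meets at least `c * |J|`
rows, where `c = d(1 - e⁻¹ - ε)`.

Expansion suffices deterministically. Applied to the level sets `{k | t < |z k|}` and integrated
over `t`, it shows that the row maxima of `M j k * |z k|` sum to at least `c‖z‖₁`
(`l1norm_le_sum_of_expansion`). The row square roots dominate these maxima. For `Az`, each row is at
least twice its maximum minus its absolute sum, and the absolute sums total `d‖z‖₁`, so the constant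
is `2c - d`.

Expansion is likely. The number of rows missed by `k` columns has its mgf bounded by that of a
binomial with `m` trials and success probability `(1 - 1/s)^k`, although rows are dependent
(`mgf_uncovered_le`). A Chernoff bound at parameter `ε` gives failure probability at most
`exp(-ε²d/2)^k ≤ (ξ/n)^k`. Empty sets and single columns never fail, and the sum over all `|J| ≥ 2`
is below `ξ`. -/

/-! ### Deterministic consequences of expansion -/

/-- The rows that meet one of the columns in `J`. -/
noncomputable def coveredRows {m n : ℕ} (M : Matrix (Fin m) (Fin n) ℝ) (J : Finset (Fin n)) :
    Finset (Fin m) := by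
  classical exact Finset.univ.filter fun j => ∃ k ∈ J, M j k = 1

lemma mem_coveredRows {m n : ℕ} {M : Matrix (Fin m) (Fin n) ℝ} {J : Finset (Fin n)} {j : Fin m} :
    j ∈ coveredRows M J ↔ ∃ k ∈ J, M j k = 1 := by
  simp [coveredRows]

lemma l1norm_nonneg {k : ℕ} (v : Fin k → ℝ) : 0 ≤ l1norm v :=
  Finset.sum_nonneg fun _ _ => abs_nonneg _

lemma sum_entries_eq_of_mem_binaryColumns {m d : ℕ} {v : Fin m → ℝ} (hv : v ∈ binaryColumns m d) :
    ∑ j, v j = d := by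
  classical
  obtain ⟨h01, hcard⟩ := hv
  have h : ∀ j, v j = if v j = 1 then 1 else 0 := fun j => by
    rcases h01 j with h | h <;> simp [h]
  rw [Finset.sum_congr rfl fun j _ => h j, Finset.sum_boole, ← hcard, ← Set.ncard_coe_finset]
  simp

lemma intervalIntegrable_ite_lt (x a b : ℝ) :
    IntervalIntegrable (fun t => if t < x then (1 : ℝ) else 0) volume a b := by
  refine Antitone.intervalIntegrable fun s t hst => ?_
  by_cases h : t < x
  · simp [h, hst.trans_lt h]
  · simp only [h, if_false]; split_ifs <;> norm_num

lemma intervalIntegrable_sum_ite_lt {n : ℕ} (x : Fin n → ℝ) (a b : ℝ) :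
    IntervalIntegrable (fun t => ∑ i, if t < x i then (1 : ℝ) else 0) volume a b := by
  simpa only [Finset.sum_fn] using
    IntervalIntegrable.sum Finset.univ fun i _ => intervalIntegrable_ite_lt (x i) a b

lemma integral_ite_lt {x T : ℝ} (hx : 0 ≤ x) (hxT : x ≤ T) :
    ∫ t in (0 : ℝ)..T, (if t < x then (1 : ℝ) else 0) = x := by
  rw [← intervalIntegral.integral_add_adjacent_intervals
    (intervalIntegrable_ite_lt x 0 x) (intervalIntegrable_ite_lt x x T)]
  have h1 : ∫ t in (0 : ℝ)..x, (if t < x then (1 : ℝ) else 0) = ∫ _ in (0 : ℝ)..x, (1 : ℝ) := by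
    rw [intervalIntegral.integral_of_le hx, intervalIntegral.integral_of_le hx,
      integral_Ioc_eq_integral_Ioo, integral_Ioc_eq_integral_Ioo]
    exact setIntegral_congr_fun measurableSet_Ioo fun t ht => by simp [ht.2]
  have h2 : ∫ t in x..T, (if t < x then (1 : ℝ) else 0) = ∫ _ in x..T, (0 : ℝ) := by
    rw [intervalIntegral.integral_of_le hxT, intervalIntegral.integral_of_le hxT]
    exact setIntegral_congr_fun measurableSet_Ioc fun t ht => by simp [ht.1.le]
  rw [h1, h2]; simp

/-- Expansion of the bipartite graph of a binary matrix, tested on the level sets of `|z|`, bounds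
the sum of the largest entries of the rows of `(a_{j,k} |z_k|)` from below. -/
lemma l1norm_le_sum_of_expansion {m n s : ℕ} {M : Matrix (Fin m) (Fin n) ℝ} {c : ℝ}
    (hexp : ∀ J : Finset (Fin n), J.card ≤ s → c * J.card ≤ (coveredRows M J).card)
    {z : Fin n → ℝ} (hz : IsSparse s z) {y : Fin m → ℝ}
    (hy0 : ∀ j, 0 ≤ y j) (hy : ∀ j k, M j k * |z k| ≤ y j) :
    c * l1norm z ≤ ∑ j, y j := by
  classical
  -- Any common upper bound for the `|z k|` and `y j` would do as upper limit of the layer-cake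
  -- integrals; this one needs no maximum.
  set T : ℝ := l1norm z + ∑ j, y j
  have hyT : ∀ j, y j ≤ T := fun j =>
    (Finset.single_le_sum (fun i _ => hy0 i) (Finset.mem_univ j)).trans
      (le_add_of_nonneg_left (l1norm_nonneg z))
  have hzT : ∀ k, |z k| ≤ T := fun k =>
    (Finset.single_le_sum (f := fun i => |z i|) (fun i _ => abs_nonneg _)
      (Finset.mem_univ k)).trans (le_add_of_nonneg_right (Finset.sum_nonneg fun j _ => hy0 j))
  have hT : 0 ≤ T := add_nonneg (l1norm_nonneg z) (Finset.sum_nonneg fun j _ => hy0 j)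
  have e1 : c * l1norm z = ∫ t in (0 : ℝ)..T, c * ∑ k, (if t < |z k| then (1 : ℝ) else 0) := by
    rw [intervalIntegral.integral_const_mul,
      intervalIntegral.integral_finsetSum fun k _ => intervalIntegrable_ite_lt _ _ _]
    simp_rw [integral_ite_lt (abs_nonneg _) (hzT _), l1norm]
  have e2 : ∑ j, y j = ∫ t in (0 : ℝ)..T, ∑ j, (if t < y j then (1 : ℝ) else 0) := by
    rw [intervalIntegral.integral_finsetSum fun k _ => intervalIntegrable_ite_lt _ _ _]
    exact Finset.sum_congr rfl fun j _ => (integral_ite_lt (hy0 j) (hyT j)).symm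
  rw [e1, e2]
  refine intervalIntegral.integral_mono_on hT
    ((intervalIntegrable_sum_ite_lt _ _ _).const_mul c)
    (intervalIntegrable_sum_ite_lt _ _ _) fun t ht => ?_
  rw [Finset.sum_boole, Finset.sum_boole]
  refine (hexp _ ?_).trans ?_
  · refine le_trans ?_ hz
    rw [← Set.ncard_coe_finset]
    refine Set.ncard_le_ncard (fun k hk => ?_) (Set.toFinite _)
    simp only [Finset.coe_filter, Finset.mem_univ, true_and, Set.mem_ofPred_eq] at hk
    exact abs_pos.1 (ht.1.trans_lt hk)
  -- A row met by a column of the level set at height `t` has `y j > t`.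
  · refine Nat.cast_le.2 (Finset.card_le_card fun j hj => ?_)
    obtain ⟨k, hk, hjk⟩ := mem_coveredRows.1 hj
    simp only [Finset.mem_filter, Finset.mem_univ, true_and] at hk ⊢
    exact hk.trans_le (by simpa [hjk] using hy j k)

lemma exists_row_maximizer {m n : ℕ} (hn : 0 < n) (M : Matrix (Fin m) (Fin n) ℝ) (z : Fin n → ℝ) :
    ∃ κ : Fin m → Fin n, ∀ j k, M j k * |z k| ≤ M j (κ j) * |z (κ j)| := by
  have : Nonempty (Fin n) := ⟨⟨0, hn⟩⟩
  choose κ hκ using fun j => Finite.exists_max fun k => M j k * |z k|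
  exact ⟨κ, hκ⟩

lemma sum_sum_mul_abs_eq {m n d : ℕ} {M : Matrix (Fin m) (Fin n) ℝ}
    (hcol : ∀ k, (fun j => M j k) ∈ binaryColumns m d) (z : Fin n → ℝ) :
    ∑ j, ∑ k, M j k * |z k| = d * l1norm z := by
  rw [Finset.sum_comm, l1norm, Finset.mul_sum]
  refine Finset.sum_congr rfl fun k _ => ?_
  rw [← Finset.sum_mul, sum_entries_eq_of_mem_binaryColumns (hcol k)]

lemma nonneg_of_mem_binaryColumns {m d : ℕ} {v : Fin m → ℝ} (hv : v ∈ binaryColumns m d)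
    (j : Fin m) : 0 ≤ v j := by
  rcases hv.1 j with h | h <;> simp [h]

lemma l1norm_mulVec_le {m n d : ℕ} {M : Matrix (Fin m) (Fin n) ℝ}
    (hcol : ∀ k, (fun j => M j k) ∈ binaryColumns m d) (z : Fin n → ℝ) :
    l1norm (M.mulVec z) ≤ d * l1norm z := by
  rw [← sum_sum_mul_abs_eq hcol]
  refine Finset.sum_le_sum fun j _ =>
    (Finset.abs_sum_le_sum_abs (fun k => M j k * z k) Finset.univ).trans_eq ?_
  exact Finset.sum_congr rfl fun k _ => by
    rw [abs_mul, abs_of_nonneg (nonneg_of_mem_binaryColumns (hcol k) j)]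

/-- Triangle inequality: the other terms can cancel at most their total absolute value from `f i`.
-/
lemma two_mul_abs_sub_sum_abs_le_abs_sum {n : ℕ} (f : Fin n → ℝ) (i : Fin n) :
    2 * |f i| - ∑ k, |f k| ≤ |∑ k, f k| := by
  rw [← Finset.add_sum_erase _ (fun k => |f k|) (Finset.mem_univ i),
    ← Finset.add_sum_erase _ f (Finset.mem_univ i)]
  have h := Finset.abs_sum_le_sum_abs f (Finset.univ.erase i)
  have h' := abs_add_le (f i + ∑ k ∈ Finset.univ.erase i, f k) (-∑ k ∈ Finset.univ.erase i, f k)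
  rw [add_neg_cancel_right, abs_neg] at h'
  linarith

section Expansion

variable {m n s d : ℕ} {M : Matrix (Fin m) (Fin n) ℝ} {c : ℝ} {z : Fin n → ℝ}

lemma le_l1norm_mulVec_of_expansion (hn : 0 < n)
    (hcol : ∀ k, (fun j => M j k) ∈ binaryColumns m d)
    (hexp : ∀ J : Finset (Fin n), J.card ≤ s → c * J.card ≤ (coveredRows M J).card)
    (hz : IsSparse s z) :
    (2 * c - d) * l1norm z ≤ l1norm (M.mulVec z) := by
  obtain ⟨κ, hκ⟩ := exists_row_maximizer hn M z
  have hM : ∀ j k, 0 ≤ M j k := fun j k => nonneg_of_mem_binaryColumns (hcol k) j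
  have h := l1norm_le_sum_of_expansion hexp hz
    (fun j => mul_nonneg (hM j (κ j)) (abs_nonneg _)) hκ
  have h2 : 2 * ∑ j, M j (κ j) * |z (κ j)| - ∑ j, ∑ k, M j k * |z k| ≤ l1norm (M.mulVec z) := by
    rw [Finset.mul_sum, ← Finset.sum_sub_distrib]
    refine Finset.sum_le_sum fun j _ => ?_
    have := two_mul_abs_sub_sum_abs_le_abs_sum (fun k => M j k * z k) (κ j)
    simp only [abs_mul, abs_of_nonneg (hM _ _)] at this
    exact this
  rw [sum_sum_mul_abs_eq hcol] at h2
  linarith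

/-- The square root of a row sum dominates each single term, since a 0/1 entry equals its square. -/
lemma le_sum_sqrt_of_expansion
    (hcol : ∀ k, (fun j => M j k) ∈ binaryColumns m d)
    (hexp : ∀ J : Finset (Fin n), J.card ≤ s → c * J.card ≤ (coveredRows M J).card)
    (hz : IsSparse s z) :
    c * l1norm z ≤ ∑ j, Real.sqrt (∑ k, M j k * z k ^ 2) := by
  have hM : ∀ j k, 0 ≤ M j k := fun j k => nonneg_of_mem_binaryColumns (hcol k) j
  refine l1norm_le_sum_of_expansion hexp hz
    (fun j => Real.sqrt_nonneg _) fun j k => Real.le_sqrt_of_sq_le ?_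
  have h := Finset.single_le_sum (f := fun i => M j i * z i ^ 2)
    (fun i _ => mul_nonneg (hM j i) (sq_nonneg _)) (Finset.mem_univ k)
  rw [mul_pow, sq_abs]
  rcases (hcol k).1 j with h' | h' <;> simp only [h'] at h ⊢ <;> linarith

end Expansion

lemma hasOneRIP_inv_smul {m n s d : ℕ} (hd : 0 < d) {M : Matrix (Fin m) (Fin n) ℝ} {θ : ℝ}
    (hθ : 0 ≤ θ)
    (h : ∀ z : Fin n → ℝ, IsSparse s z → (d : ℝ) * (1 - θ) * l1norm z ≤ l1norm (M.mulVec z) ∧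
      l1norm (M.mulVec z) ≤ (d : ℝ) * l1norm z) :
    HasOneRIP ((d : ℝ)⁻¹ • M) s θ := by
  intro z hz
  obtain ⟨h1, h2⟩ := h z hz
  have hd' : (0 : ℝ) < d := Nat.cast_pos.2 hd
  have e : l1norm (((d : ℝ)⁻¹ • M).mulVec z) = (d : ℝ)⁻¹ * l1norm (M.mulVec z) := by
    rw [Matrix.smul_mulVec, l1norm, l1norm, Finset.mul_sum]
    simp [abs_mul]
  rw [e, le_inv_mul_iff₀ hd', inv_mul_le_iff₀ hd', ← mul_assoc]
  exact ⟨h1, h2.trans (mul_le_mul_of_nonneg_left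
    (le_mul_of_one_le_left (l1norm_nonneg z) (by linarith)) hd'.le)⟩

/-! ### Counting columns that avoid a set of rows -/

lemma indicator_finset_injective (m : ℕ) :
    Function.Injective fun (T : Finset (Fin m)) (j : Fin m) => if j ∈ T then (1 : ℝ) else 0 := by
  intro T T' h
  ext j
  have := congrFun h j
  by_cases h1 : j ∈ T <;> by_cases h2 : j ∈ T' <;> simp_all

lemma binaryColumns_inter_avoid (m d : ℕ) (S : Finset (Fin m)) :
    binaryColumns m d ∩ {v | ∀ j ∈ S, v j ≠ 1} =
      (fun (T : Finset (Fin m)) (j : Fin m) => if j ∈ T then (1 : ℝ) else 0) ''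
        ((Finset.univ \ S).powersetCard d : Finset (Finset (Fin m))) := by
  classical
  ext v
  constructor
  · rintro ⟨⟨h01, hc⟩, hS⟩
    refine ⟨Finset.univ.filter fun j => v j = 1, ?_, ?_⟩
    · rw [Finset.mem_coe, Finset.mem_powersetCard]
      refine ⟨fun j hj => ?_, ?_⟩
      · simp only [Finset.mem_filter, Finset.mem_univ, true_and, Finset.mem_sdiff] at hj ⊢
        exact fun hjS => hS j hjS hj
      · rw [← hc, ← Set.ncard_coe_finset]; simp
    · funext j
      rcases h01 j with h | h <;> simp [h]
  · rintro ⟨T, hT, rfl⟩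
    rw [Finset.mem_coe, Finset.mem_powersetCard] at hT
    refine ⟨⟨fun j => by by_cases h : j ∈ T <;> simp [h], ?_⟩, fun j hj => ?_⟩
    · rw [← hT.2, ← Set.ncard_coe_finset]
      congr 1
      ext j
      simp
    · have : j ∉ T := fun h => (Finset.mem_sdiff.1 (hT.1 h)).2 hj
      simp [this]

lemma ncard_binaryColumns_inter_avoid (m d : ℕ) (S : Finset (Fin m)) :
    (binaryColumns m d ∩ {v | ∀ j ∈ S, v j ≠ 1}).ncard = (m - S.card).choose d := by
  rw [binaryColumns_inter_avoid, Set.ncard_image_of_injective _ (indicator_finset_injective m),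
    Set.ncard_coe_finset, Finset.card_powersetCard, Finset.card_univ_sdiff, Fintype.card_fin]

lemma ncard_binaryColumns (m d : ℕ) : (binaryColumns m d).ncard = m.choose d := by
  simpa using ncard_binaryColumns_inter_avoid m d ∅

lemma finite_binaryColumns (m d : ℕ) : (binaryColumns m d).Finite := by
  have h := binaryColumns_inter_avoid m d ∅
  simp only [Finset.notMem_empty, false_imp_iff, implies_true, Set.ofPred_true, Set.inter_univ] at h
  exact h ▸ (Finset.finite_toSet _).image _

lemma uniformOn_real_eq {α : Type*} [MeasurableSpace α] [MeasurableSingletonClass α] {s : Set α}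
    (hs : s.Finite) (t : Set α) : (uniformOn s).real t = (s ∩ t).ncard / s.ncard := by
  have hst : (s ∩ t).Finite := hs.inter_of_left t
  rw [Measure.real, uniformOn, cond_apply hs.measurableSet, Measure.count_apply_finite _ hs,
    Measure.count_apply_finite _ hst, ENNReal.toReal_mul, ENNReal.toReal_inv,
    Set.ncard_eq_toFinset_card _ hs, Set.ncard_eq_toFinset_card _ hst]
  simp [div_eq_inv_mul]

/-- Drawing without replacement avoids `r` rows no more often than independent rows would: each step
of the ratio is `1 - d/(a+1)` with `a + 1 ≤ m`. -/
lemma choose_sub_div_choose_le {m d : ℕ} (hdm : d ≤ m) (hm : 0 < m) (r : ℕ) (hr : r ≤ m) :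
    ((m - r).choose d : ℝ) / m.choose d ≤ (1 - d / m : ℝ) ^ r := by
  have hm' : (0 : ℝ) < m := Nat.cast_pos.2 hm
  have hc : (0 : ℝ) < m.choose d := Nat.cast_pos.2 (Nat.choose_pos hdm)
  have hq : (0 : ℝ) ≤ 1 - d / m := by
    rw [sub_nonneg, div_le_one hm']; exact_mod_cast hdm
  rw [div_le_iff₀ hc]
  induction r with
  | zero => simp
  | succ r ih =>
    obtain ⟨a, rfl⟩ : ∃ a, m = a + 1 + r := ⟨m - (r + 1), by omega⟩
    have e1 : a + 1 + r - (r + 1) = a := by omega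
    have e2 : a + 1 + r - r = a + 1 := by omega
    specialize ih (by omega)
    rw [e2] at ih
    rw [e1, pow_succ]
    by_cases had : a < d
    · rw [Nat.choose_eq_zero_of_lt had, Nat.cast_zero]
      exact mul_nonneg (mul_nonneg (pow_nonneg hq r) hq) hc.le
    have key : (a.choose d : ℝ) * (a + 1) = (a + 1).choose d * (a + 1 - d) := by
      have := Nat.choose_mul_succ_eq a d
      have h2 : ((a + 1 - d : ℕ) : ℝ) = a + 1 - d := by
        rw [Nat.cast_sub (by omega)]; push_cast; rfl
      rw [← h2]
      exact_mod_cast this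
    have h3 : (a.choose d : ℝ) ≤ (a + 1).choose d * (1 - d / (a + 1 + r : ℕ)) := by
      have ha : (0 : ℝ) < a + 1 := by positivity
      have : (a.choose d : ℝ) = (a + 1).choose d * (1 - d / (a + 1)) := by
        field_simp; linarith
      rw [this]
      gcongr
      push_cast; linarith
    calc (a.choose d : ℝ) ≤ (a + 1).choose d * (1 - d / (a + 1 + r : ℕ)) := h3
      _ ≤ _ := by
        rw [mul_right_comm]
        exact mul_le_mul_of_nonneg_right ih hq

/-! ### Moment generating function of the number of uncovered rows -/

lemma measurableSet_avoid {m : ℕ} (S : Finset (Fin m)) :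
    MeasurableSet {v : Fin m → ℝ | ∀ j ∈ S, v j ≠ 1} := by
  have : {v : Fin m → ℝ | ∀ j ∈ S, v j ≠ 1} = ⋂ j ∈ S, (fun v => v j) ⁻¹' {1}ᶜ := by
    ext; simp
  rw [this]
  exact Finset.measurableSet_biInter _ fun j _ =>
    measurable_pi_apply j (measurableSet_singleton _).compl

lemma avoidEvent_eq {Ω : Type*} {m n : ℕ} (A : Ω → Matrix (Fin m) (Fin n) ℝ) (J : Finset (Fin n)) (S : Finset (Fin m)) :
    {ω | ∀ j ∈ S, j ∉ coveredRows (A ω) J} =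
      ⋂ k ∈ J, (fun ω j => A ω j k) ⁻¹' {v | ∀ j ∈ S, v j ≠ 1} := by
  ext ω
  simp only [mem_coveredRows, not_exists, not_and, Set.mem_ofPred_eq, Set.mem_iInter,
    Set.mem_preimage]
  exact ⟨fun h k hk j hj => h j hj k hk, fun h j hj k hk => h k hk j hj⟩

/-- Each row contributes a factor `1 + (exp t - 1) * 1_uncovered`. Expanding the product reduces the
mgf to probabilities that a whole set `S` is missed, which the column law controls. -/
lemma exp_mul_card_compl_coveredRows {m n : ℕ} (M : Matrix (Fin m) (Fin n) ℝ) (J : Finset (Fin n)) (t : ℝ) :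
    Real.exp (t * (m - (coveredRows M J).card)) =
      ∑ S : Finset (Fin m), (Real.exp t - 1) ^ S.card *
        (if ∀ j ∈ S, j ∉ coveredRows M J then 1 else 0) := by
  classical
  have h1 : (m : ℝ) - (coveredRows M J).card = ∑ j, if j ∉ coveredRows M J then (1 : ℝ) else 0 := by
    have : ∀ j, (if j ∉ coveredRows M J then (1 : ℝ) else 0) =
        1 - if j ∈ coveredRows M J then (1 : ℝ) else 0 := fun j => by
      by_cases h : j ∈ coveredRows M J <;> simp [h]
    simp_rw [this]
    simp
  rw [h1, Finset.mul_sum, Real.exp_sum]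
  have h2 : ∀ j, Real.exp (t * if j ∉ coveredRows M J then (1 : ℝ) else 0) =
      1 + (Real.exp t - 1) * if j ∉ coveredRows M J then (1 : ℝ) else 0 := fun j => by
    by_cases h : j ∈ coveredRows M J <;> simp [h]
  simp_rw [h2]
  rw [Finset.prod_one_add, Finset.powerset_univ]
  refine Finset.sum_congr rfl fun S _ => ?_
  rw [Finset.prod_mul_distrib, Finset.prod_const, Finset.prod_boole]
  congr

section Random

variable {Ω : Type*} [MeasurableSpace Ω] {P : Measure Ω} {m n d : ℕ}
  {A : Ω → Matrix (Fin m) (Fin n) ℝ}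

namespace IsRandomBinaryMatrix

lemma measurableSet_avoidEvent (hA : IsRandomBinaryMatrix P d A) (J : Finset (Fin n))
    (S : Finset (Fin m)) : MeasurableSet {ω | ∀ j ∈ S, j ∉ coveredRows (A ω) J} := by
  rw [avoidEvent_eq]
  exact Finset.measurableSet_biInter _ fun k _ => hA.measurable_col k (measurableSet_avoid S)

lemma real_avoidEvent_le (hA : IsRandomBinaryMatrix P d A) (hdm : d ≤ m) (hm : 0 < m)
    (J : Finset (Fin n)) (S : Finset (Fin m)) :
    P.real {ω | ∀ j ∈ S, j ∉ coveredRows (A ω) J} ≤ ((1 - d / m : ℝ) ^ J.card) ^ S.card := by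
  rw [avoidEvent_eq, Measure.real, hA.indep_col.measure_inter_preimage_eq_mul J
    fun _ _ => measurableSet_avoid S, ENNReal.toReal_prod, ← pow_mul, mul_comm, pow_mul,
    ← Finset.prod_const]
  refine Finset.prod_le_prod (fun _ _ => ENNReal.toReal_nonneg) fun k _ => ?_
  rw [← Measure.map_apply (hA.measurable_col k) (measurableSet_avoid S), hA.law_col k]
  have := uniformOn_real_eq (finite_binaryColumns m d) {v | ∀ j ∈ S, v j ≠ 1}
  rw [ncard_binaryColumns_inter_avoid, ncard_binaryColumns] at this
  exact this.trans_le (choose_sub_div_choose_le hdm hm _ (by simpa using S.card_le_univ))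

lemma ae_col_mem (hA : IsRandomBinaryMatrix P d A) (hdm : d ≤ m) :
    ∀ᵐ ω ∂P, ∀ k, (fun j => A ω j k) ∈ binaryColumns m d := by
  rw [ae_all_iff]
  intro k
  have hfin := finite_binaryColumns m d
  have hne : (binaryColumns m d).Nonempty := by
    rw [← Set.ncard_pos hfin, ncard_binaryColumns]
    exact Nat.choose_pos hdm
  have := isProbabilityMeasure_uniformOn hfin hne
  have h : ∀ᵐ v ∂(P.map fun ω j => A ω j k), v ∈ binaryColumns m d := by
    rw [hA.law_col k]
    exact (mem_ae_iff_prob_eq_one hfin.measurableSet).2 (uniformOn_self hfin hne)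
  exact ae_of_ae_map (hA.measurable_col k).aemeasurable h

end IsRandomBinaryMatrix

lemma IsRandomBinaryMatrix.integrable_exp_uncovered [IsProbabilityMeasure P]
    (hA : IsRandomBinaryMatrix P d A) (J : Finset (Fin n)) (t : ℝ) :
    Integrable (fun ω => Real.exp (t * (m - (coveredRows (A ω) J).card))) P := by
  simp_rw [exp_mul_card_compl_coveredRows]
  refine integrable_finsetSum _ fun S _ => Integrable.const_mul ?_ _
  exact (integrable_const (1 : ℝ)).indicator (hA.measurableSet_avoidEvent J S) |>.congr
    (ae_of_all _ fun ω => by simp [Set.indicator_apply])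

/-- For `t ≥ 0` all coefficients `(exp t - 1)^|S|` are nonnegative, so the avoidance bounds can be
inserted termwise; the binomial theorem resums them. -/
lemma IsRandomBinaryMatrix.mgf_uncovered_le [IsProbabilityMeasure P]
    (hA : IsRandomBinaryMatrix P d A) (hdm : d ≤ m) (hm : 0 < m) (J : Finset (Fin n))
    {t : ℝ} (ht : 0 ≤ t) :
    mgf (fun ω => (m - (coveredRows (A ω) J).card : ℝ)) P t ≤
      (1 + (Real.exp t - 1) * (1 - d / m : ℝ) ^ J.card) ^ m := by
  have hind : ∀ (S : Finset (Fin m)) (ω : Ω),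
      (if ∀ j ∈ S, j ∉ coveredRows (A ω) J then (1 : ℝ) else 0) =
        {ω | ∀ j ∈ S, j ∉ coveredRows (A ω) J}.indicator 1 ω := fun S ω => by
    simp [Set.indicator_apply]
  have ht' : 0 ≤ Real.exp t - 1 := sub_nonneg.2 (Real.one_le_exp ht)
  rw [mgf]
  simp_rw [exp_mul_card_compl_coveredRows, hind]
  rw [integral_finsetSum]
  · simp_rw [integral_const_mul, integral_indicator_one (hA.measurableSet_avoidEvent J _)]
    have h := Fintype.sum_pow_mul_eq_add_pow (Fin m)
      ((Real.exp t - 1) * (1 - d / m : ℝ) ^ J.card) 1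
    rw [add_comm, Fintype.card_fin] at h
    rw [← h]
    refine Finset.sum_le_sum fun S _ => ?_
    rw [one_pow, mul_one, mul_pow]
    exact mul_le_mul_of_nonneg_left (hA.real_avoidEvent_le hdm hm J S) (pow_nonneg ht' _)
  · exact fun S _ => ((integrable_const (1 : ℝ)).indicator
      (hA.measurableSet_avoidEvent J S)).const_mul _

end Random

/-! ### Numerical estimates for the Chernoff and union bounds -/

lemma exp_neg_le_quadratic {x : ℝ} (hx : 0 ≤ x) : Real.exp (-x) ≤ 1 - x + x ^ 2 / 2 := by
  have h := Real.quadratic_le_exp_of_nonneg hx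
  have h0 : 0 < 1 + x + x ^ 2 / 2 := by positivity
  have h1 : 0 ≤ 1 - x + x ^ 2 / 2 := by nlinarith [sq_nonneg (x - 1)]
  -- `(1 - x + x²/2)(1 + x + x²/2) = 1 + x⁴/4`.
  have h2 : 1 ≤ (1 - x + x ^ 2 / 2) * Real.exp x :=
    le_trans (by nlinarith [sq_nonneg (x ^ 2)]) (mul_le_mul_of_nonneg_left h h1)
  rw [Real.exp_neg, inv_le_iff_one_le_mul₀ (Real.exp_pos x)]
  exact h2

/-- Convexity: on `[0, 1]` the graph lies below its chord. This is the source of the constant `1 -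
e⁻¹`. -/
lemma exp_neg_le_chord {x : ℝ} (h0 : 0 ≤ x) (h1 : x ≤ 1) :
    Real.exp (-x) ≤ 1 - x * (1 - Real.exp (-1)) := by
  have h := convexOn_exp.2 (Set.mem_univ (-1)) (Set.mem_univ 0) h0 (sub_nonneg.2 h1) (by ring)
  simp only [smul_eq_mul, mul_neg, mul_one, mul_zero, add_zero, Real.exp_zero] at h
  linarith

lemma one_sub_inv_pow_le {s k : ℕ} (hs : 0 < s) (hk : k ≤ s) :
    (1 - (s : ℝ)⁻¹) ^ k ≤ 1 - k / s * (1 - Real.exp (-1)) := by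
  have hs' : (1 : ℝ) ≤ s := Nat.one_le_cast.2 hs
  have h0 : 0 ≤ 1 - (s : ℝ)⁻¹ := sub_nonneg.2 (inv_le_one_of_one_le₀ hs')
  refine le_trans ?_ (exp_neg_le_chord (by positivity)
    (div_le_one_of_le₀ (Nat.cast_le.2 hk) (by positivity)))
  calc (1 - (s : ℝ)⁻¹) ^ k ≤ Real.exp (-(s : ℝ)⁻¹) ^ k :=
        pow_le_pow_left₀ h0 (Real.one_sub_le_exp_neg _) k
    _ = Real.exp (-(k / s)) := by rw [← Real.exp_nat_mul]; congr 1; ring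

lemma one_sub_div_le_one_sub_inv_pow {s : ℕ} (hs : 0 < s) (k : ℕ) :
    1 - k / s ≤ (1 - (s : ℝ)⁻¹) ^ k := by
  have hs' : (s : ℝ)⁻¹ ≤ 1 := inv_le_one_of_one_le₀ (Nat.one_le_cast.2 hs)
  have h := one_add_mul_le_pow (a := -(s : ℝ)⁻¹) (by linarith) k
  rw [← sub_eq_add_neg] at h
  refine le_trans (le_of_eq ?_) h
  ring

/-- The Chernoff exponent for the number of rows that `k` random columns leave uncovered. -/
lemma chernoff_exponent_bound {s d k : ℕ} (hs : 0 < s) (hk : k ≤ s) {ε : ℝ} (hε : 0 < ε) :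
    Real.exp (-ε * ((d * s : ℕ) - d * (1 - Real.exp (-1) - ε) * k)) *
      (1 + (Real.exp ε - 1) * (1 - (s : ℝ)⁻¹) ^ k) ^ (d * s) ≤
      Real.exp (-(ε ^ 2 * d / 2)) ^ k := by
  have hs' : (0 : ℝ) < s := Nat.cast_pos.2 hs
  set p : ℝ := (1 - (s : ℝ)⁻¹) ^ k
  have hp1 : p ≤ 1 - k / s * (1 - Real.exp (-1)) := one_sub_inv_pow_le hs hk
  have hp2 : 1 - k / s ≤ p := one_sub_div_le_one_sub_inv_pow hs k
  have hp0 : 0 ≤ p := pow_nonneg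
    (sub_nonneg.2 (inv_le_one_of_one_le₀ (Nat.one_le_cast.2 hs))) k
  have he : Real.exp (-1) ≤ 1 := Real.exp_le_one_iff.2 (by norm_num)
  have hq0 : 0 ≤ 1 - p := by
    have : 0 ≤ (k : ℝ) / s * (1 - Real.exp (-1)) := mul_nonneg (by positivity) (by linarith)
    linarith
  have base : 1 + (Real.exp ε - 1) * p ≤
      Real.exp (ε - (1 - p) * (ε - ε ^ 2 / 2)) := by
    have e1 : 1 + (Real.exp ε - 1) * p =
        Real.exp ε * (1 - (1 - p) * (1 - Real.exp (-ε))) := by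
      have : Real.exp ε * Real.exp (-ε) = 1 := by rw [← Real.exp_add]; simp
      linear_combination (1 - p) * (-this)
    rw [e1, sub_eq_add_neg ε, Real.exp_add]
    refine mul_le_mul_of_nonneg_left ((Real.one_sub_le_exp_neg _).trans ?_) (Real.exp_pos _).le
    refine Real.exp_le_exp.2 (neg_le_neg (mul_le_mul_of_nonneg_left ?_ hq0))
    linarith [exp_neg_le_quadratic hε.le]
  have hbase0 : 0 ≤ 1 + (Real.exp ε - 1) * p := by
    have : 0 ≤ (Real.exp ε - 1) * p := mul_nonneg (sub_nonneg.2 (Real.one_le_exp hε.le)) hp0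
    linarith
  refine (mul_le_mul_of_nonneg_left (pow_le_pow_left₀ hbase0 base (d * s))
    (Real.exp_pos _).le).trans ?_
  rw [← Real.exp_nat_mul, ← Real.exp_nat_mul, ← Real.exp_add, Real.exp_le_exp]
  push_cast
  -- The mean number of covered rows is bounded on both sides: the lower bound `a2` serves the term
  -- linear in `ε`, the upper bound `a1` the term in `ε²`. Used separately, they need no upper limit
  -- on `ε`.
  have a1 : (d * s : ℝ) * (1 - p) ≤ d * k := by
    have : (d * s : ℝ) * (1 - p) ≤ d * s * (k / s) :=
      mul_le_mul_of_nonneg_left (by linarith) (by positivity)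
    rwa [mul_assoc, mul_assoc, mul_div_cancel₀ _ hs'.ne', ← mul_assoc] at this
  have a2 : (d * k : ℝ) * (1 - Real.exp (-1)) ≤ d * s * (1 - p) := by
    have : (d * s : ℝ) * (k / s * (1 - Real.exp (-1))) ≤ d * s * (1 - p) :=
      mul_le_mul_of_nonneg_left (by linarith) (by positivity)
    refine le_trans (le_of_eq ?_) this
    field_simp
  have a3 := mul_le_mul_of_nonneg_left a1 (by positivity : 0 ≤ ε ^ 2 / 2)
  have a4 := mul_le_mul_of_nonneg_left a2 hε.le
  nlinarith

lemma exp_neg_le_of_two_mul_log_le {n d : ℕ} {ξ ε : ℝ} (hn : 0 < n) (hξ : 0 < ξ) (hε : 0 < ε)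
    (hd : 2 * (ε ^ 2)⁻¹ * Real.log ((n : ℝ) / ξ) ≤ d) :
    Real.exp (-(ε ^ 2 * d / 2)) ≤ ξ / n := by
  have hn' : (0 : ℝ) < n := Nat.cast_pos.2 hn
  rw [← Real.le_log_iff_exp_le (by positivity), ← inv_div (n : ℝ) ξ, Real.log_inv, neg_le_neg_iff]
  have := mul_le_mul_of_nonneg_left hd (by positivity : 0 ≤ ε ^ 2 / 2)
  have e : ε ^ 2 / 2 * (2 * (ε ^ 2)⁻¹ * Real.log ((n : ℝ) / ξ)) = Real.log ((n : ℝ) / ξ) := by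
    field_simp
  rw [e] at this
  linarith

lemma sum_pow_card_of_two_le_card {n : ℕ} (x : ℝ) :
    ∑ J : Finset (Fin n) with 2 ≤ J.card, x ^ J.card = (1 + x) ^ n - 1 - n * x := by
  classical
  have h := Fintype.sum_pow_mul_eq_add_pow (Fin n) x 1
  rw [add_comm, Fintype.card_fin] at h
  simp only [one_pow, mul_one] at h
  have h1 : ∑ J : Finset (Fin n) with ¬ 2 ≤ J.card, x ^ J.card = 1 + n * x := by
    have : (Finset.univ.filter fun J : Finset (Fin n) => ¬ 2 ≤ J.card) =
        insert ∅ (Finset.univ.image fun k : Fin n => ({k} : Finset (Fin n))) := by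
      ext J
      simp only [Finset.mem_filter, Finset.mem_univ, true_and, Finset.mem_insert, Finset.mem_image]
      rw [not_le, Nat.lt_succ_iff, Nat.le_one_iff_eq_zero_or_eq_one, Finset.card_eq_zero,
        Finset.card_eq_one]
      exact or_congr_right ⟨fun ⟨a, ha⟩ => ⟨a, ha.symm⟩, fun ⟨a, ha⟩ => ⟨a, ha.symm⟩⟩
    rw [this, Finset.sum_insert (by simp),
      Finset.sum_image (fun a _ b _ h => Finset.singleton_injective h)]
    simp
  rw [← h, ← Finset.sum_filter_add_sum_filter_not Finset.univ
    (fun J : Finset (Fin n) => 2 ≤ J.card), h1]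
  ring

/-- The sum is at most `exp ξ - 1 - ξ ≤ ξ² < ξ`. Leaving out the sets of size at most one removes
the linear term `ξ`, which alone would exhaust the budget. -/
lemma sum_div_pow_card_lt {n : ℕ} (hn : 0 < n) {ξ : ℝ} (h0 : 0 < ξ) (h1 : ξ < 1) :
    ∑ J : Finset (Fin n) with 2 ≤ J.card, (ξ / n) ^ J.card < ξ := by
  have hn' : (0 : ℝ) < n := Nat.cast_pos.2 hn
  rw [sum_pow_card_of_two_le_card, mul_div_cancel₀ _ hn'.ne']
  have h2 : (1 + ξ / n) ^ n ≤ Real.exp ξ := by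
    calc (1 + ξ / n) ^ n ≤ Real.exp (ξ / n) ^ n :=
          pow_le_pow_left₀ (by positivity) (by linarith [Real.add_one_le_exp (ξ / n)]) n
      _ = Real.exp ξ := by rw [← Real.exp_nat_mul, mul_div_cancel₀ _ hn'.ne']
  have h3 := (abs_le.1 (Real.abs_exp_sub_one_sub_id_le (abs_le.2 ⟨by linarith, h1.le⟩))).2
  nlinarith

lemma card_coveredRows_singleton {m n d : ℕ} {M : Matrix (Fin m) (Fin n) ℝ} {k : Fin n}
    (hcol : (fun j => M j k) ∈ binaryColumns m d) : (coveredRows M {k}).card = d := by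
  rw [← hcol.2, ← Set.ncard_coe_finset]
  congr 1
  ext j
  simp [mem_coveredRows]

/-! ### Expansion with high probability, and the theorem -/

section Random

variable {Ω : Type*} [MeasurableSpace Ω] {P : Measure Ω} [IsProbabilityMeasure P] {m n s d : ℕ}
  {A : Ω → Matrix (Fin m) (Fin n) ℝ} {ε : ℝ}

lemma IsRandomBinaryMatrix.real_card_coveredRows_lt_le (hA : IsRandomBinaryMatrix P d A)
    (hd : 0 < d) (hs : 0 < s) (hm : m = d * s) (hε : 0 < ε) {J : Finset (Fin n)}
    (hJ : J.card ≤ s) :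
    P.real {ω | ((coveredRows (A ω) J).card : ℝ) < d * (1 - Real.exp (-1) - ε) * J.card} ≤
      Real.exp (-(ε ^ 2 * d / 2)) ^ J.card := by
  subst hm
  have hd' : (d : ℝ) ≠ 0 := Nat.cast_ne_zero.2 hd.ne'
  have e : (1 - d / (d * s : ℕ) : ℝ) = 1 - (s : ℝ)⁻¹ := by
    push_cast
    rw [div_mul_cancel_left₀ hd']
  have h1 := measure_ge_le_exp_mul_mgf
    (((d * s : ℕ) : ℝ) - d * (1 - Real.exp (-1) - ε) * J.card) hε.le
    (hA.integrable_exp_uncovered J ε)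
  have h2 := hA.mgf_uncovered_le (Nat.le_mul_of_pos_right d hs) (Nat.mul_pos hd hs) J hε.le
  rw [e] at h2
  refine le_trans (measureReal_mono fun ω hω => ?_) (h1.trans
    ((mul_le_mul_of_nonneg_left h2 (Real.exp_pos _).le).trans (chernoff_exponent_bound hs hJ hε)))
  rw [Set.mem_ofPred_eq] at hω ⊢
  exact sub_le_sub_left hω.le _

/-- The union bound over all sets of at least two and at most `s` columns. -/
lemma IsRandomBinaryMatrix.lt_real_expansion (hA : IsRandomBinaryMatrix P d A) (hn : 0 < n)
    (hd : 0 < d) (hs : 0 < s) (hm : m = d * s) {ξ : ℝ} (hξ0 : 0 < ξ) (hξ1 : ξ < 1) (hε : 0 < ε)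
    (hdε : 2 * (ε ^ 2)⁻¹ * Real.log ((n : ℝ) / ξ) ≤ d) :
    1 - ξ < P.real {ω | (∀ k, (fun j => A ω j k) ∈ binaryColumns m d) ∧
      ∀ J : Finset (Fin n), J.card ≤ s →
        d * (1 - Real.exp (-1) - ε) * J.card ≤ (coveredRows (A ω) J).card} := by
  set G := {ω | (∀ k, (fun j => A ω j k) ∈ binaryColumns m d) ∧
    ∀ J : Finset (Fin n), J.card ≤ s →
      d * (1 - Real.exp (-1) - ε) * J.card ≤ (coveredRows (A ω) J).card} with hG
  set N := {ω | ¬ ∀ k, (fun j => A ω j k) ∈ binaryColumns m d} with hN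
  set B : Finset (Fin n) → Set Ω := fun J => {ω | J.card ≤ s ∧
    ((coveredRows (A ω) J).card : ℝ) < d * (1 - Real.exp (-1) - ε) * J.card} with hB
  have hN0 : P.real N = 0 := by
    rw [measureReal_eq_zero_iff]
    exact hA.ae_col_mem (hm ▸ Nat.le_mul_of_pos_right d hs)
  have hBle : ∀ J, P.real (B J) ≤ (ξ / n) ^ J.card := fun J => by
    by_cases hJ : J.card ≤ s
    · refine (measureReal_mono fun ω hω => hω.2).trans
        ((hA.real_card_coveredRows_lt_le hd hs hm hε hJ).trans
          (pow_le_pow_left₀ (Real.exp_pos _).le (exp_neg_le_of_two_mul_log_le hn hξ0 hε hdε) _))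
    · have : B J = ∅ := by simp [hB, hJ]
      rw [this, measureReal_empty]
      positivity
  have hcover : (Set.univ : Set Ω) ⊆
      G ∪ (N ∪ ⋃ J ∈ Finset.univ.filter fun J : Finset (Fin n) => 2 ≤ J.card, B J) := by
    intro ω _
    by_cases hcol : ∀ k, (fun j => A ω j k) ∈ binaryColumns m d
    swap
    · exact Or.inr (Or.inl hcol)
    by_cases hbad : ∃ J : Finset (Fin n), 2 ≤ J.card ∧ ω ∈ B J
    · obtain ⟨J, hJ, hω⟩ := hbad
      exact Or.inr (Or.inr (Set.mem_biUnion (by simpa using hJ) hω))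
    refine Or.inl ⟨hcol, fun J hJ => ?_⟩
    -- Sets of size at most one satisfy the bound surely once the columns are valid: a single column
    -- meets exactly `d` rows.
    by_cases h2 : 2 ≤ J.card
    · by_contra hlt
      exact hbad ⟨J, h2, hJ, not_le.1 hlt⟩
    rcases Nat.le_one_iff_eq_zero_or_eq_one.1 (Nat.lt_succ_iff.1 (not_le.1 h2)) with h | h
    · simp [h]
    · obtain ⟨k, rfl⟩ := Finset.card_eq_one.1 h
      rw [card_coveredRows_singleton (hcol k), h, Nat.cast_one, mul_one]
      exact mul_le_of_le_one_right (Nat.cast_nonneg d) (by linarith [Real.exp_pos (-1)])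
  have h1 : (1 : ℝ) ≤ P.real G + (P.real N + ∑ J : Finset (Fin n) with 2 ≤ J.card, P.real (B J)) := by
    rw [← probReal_univ (μ := P)]
    refine (measureReal_mono hcover).trans ((measureReal_union_le _ _).trans ?_)
    gcongr
    refine (measureReal_union_le _ _).trans ?_
    gcongr
    exact measureReal_biUnion_finset_le _ _
  have h2 := (Finset.sum_le_sum fun J (_ : J ∈ Finset.univ.filter
    fun J : Finset (Fin n) => 2 ≤ J.card) => hBle J).trans_lt (sum_div_pow_card_lt hn hξ0 hξ1)
  linarith

end Random

theorem mainTheorem4 {Ω : Type*} [MeasurableSpace Ω] (P : Measure Ω) [IsProbabilityMeasure P]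
    (n s d m : ℕ) (hn : 0 < n) (hs : 0 < s) (ξ ε : ℝ) (hξ0 : 0 < ξ) (hξ1 : ξ < 1) (hε : 0 < ε)
    (hd : 2 * (ε ^ 2)⁻¹ * Real.log ((n : ℝ) / ξ) ≤ (d : ℝ)) (hm : m = d * s)
    (A : Ω → Matrix (Fin m) (Fin n) ℝ) (hA : IsRandomBinaryMatrix P d A) :
    1 - ξ < P.real {ω |
      (∀ z : Fin n → ℝ, IsSparse s z →
        (d : ℝ) * (1 - 2 * Real.exp (-1) - 2 * ε) * l1norm z ≤ l1norm ((A ω).mulVec z) ∧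
        l1norm ((A ω).mulVec z) ≤ (d : ℝ) * l1norm z) ∧
      (∀ z : Fin n → ℝ, IsSparse s z →
        (d : ℝ) * (1 - Real.exp (-1) - ε) * l1norm z ≤
          ∑ j, Real.sqrt (∑ k, A ω j k * z k ^ 2)) ∧
      HasOneRIP ((d : ℝ)⁻¹ • A ω) s (2 * Real.exp (-1) + 2 * ε)} := by
  have hd0 : 0 < d := by
    have hn' : (1 : ℝ) ≤ n := Nat.one_le_cast.2 hn
    have hlog : 0 < Real.log ((n : ℝ) / ξ) :=
      Real.log_pos ((one_lt_div hξ0).2 (hξ1.trans_le hn'))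
    have : (0 : ℝ) < d := lt_of_lt_of_le (by positivity) hd
    exact_mod_cast this
  refine (hA.lt_real_expansion hn hd0 hs hm hξ0 hξ1 hε hd).trans_le (measureReal_mono ?_)
  rintro ω ⟨hcol, hexp⟩
  have h1 : ∀ z : Fin n → ℝ, IsSparse s z →
      (d : ℝ) * (1 - 2 * Real.exp (-1) - 2 * ε) * l1norm z ≤ l1norm ((A ω).mulVec z) ∧
      l1norm ((A ω).mulVec z) ≤ (d : ℝ) * l1norm z := fun z hz => by
    refine ⟨le_trans (le_of_eq ?_) (le_l1norm_mulVec_of_expansion hn hcol hexp hz),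
      l1norm_mulVec_le hcol z⟩
    ring
  refine ⟨h1, fun z hz => le_sum_sqrt_of_expansion hcol hexp hz,
    hasOneRIP_inv_smul hd0 (by positivity) fun z hz => ?_⟩
  rw [← sub_sub]
  exact h1 z hz
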